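/- Let $T$ be a simplicial tree, not necessarily locally finite, and let $\mathrm{Aut}(T)$ be its group of automorphisms. The translation length of $g \in \mathrm{Aut}(T)$ is the minimum of $d(w, gw)$ over all points $w$ of the geometric realisation of $T$; $g$ is hyperbolic if this number is positive (so an element that fixes a vertex or inverts an edge is not hyperbolic). A subgroup of $\mathrm{Aut}(T)$ is purely hyperbolic if all of its nontrivial elements are hyperbolic. **Theorem C.** Every finitely generated purely hyperbolic subgroup of $\mathrm{Aut}(T)$ has solvable constructive membership problem. That is, there is one algorithm such that for every simplicial tree $T$, every vertex $v_0$ of $T$, every finite tuple $x_0, \dots, x_{n-1} \in \mathrm{Aut}(T)$ generating a purely hyperbolic group $G$, and every $g \in \mathrm{Aut}(T)$, the algorithm halts on the input $x_0, \dots, x_{n-1}, g$ and decides whether $g \in G$; if $g \in G$, it outputs a word in $x_0^{\pm 1}, \dots, x_{n-1}^{\pm 1}$ that represents $g$. Here the automorphisms are given as black boxes: an algorithm is a partial recursive procedure that is given $n$ and may, for words $w$ in $x_0^{\pm 1}, \dots, x_{n-1}^{\pm 1}, g^{\pm 1}$ of its choice, ask whether $w = 1$ in $\mathrm{Aut}(T)$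 and ask for the distance $d(v_0, w v_0)$. -/

import Mathlib

universe u

namespace TreeMembership

/-! ### Automorphisms of a simplicial tree: translation length, hyperbolicity -/

/-- A point of the geometric realisation of the simplicial tree `T`, in barycentric coordinates:
a finitely supported family of nonnegative weights of total mass `1` whose support is a simplex
(a clique; in a tree this is a vertex or the pair of endpoints of an edge). -/
structure RealPoint {V : Type u} (T : SimpleGraph V) where
  /-- the barycentric coordinates -/
  weight : V →₀ ℝ
  nonneg : ∀ v, 0 ≤ weight v
  total : (weight.sum fun _ a => a) = 1
  simplex : T.IsClique (weight.support : Set V)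

/-- The action of an automorphism on the geometric realisation (the linear extension of its
action on the vertices). -/
noncomputable def RealPoint.map {V : Type u} {T : SimpleGraph V} (g : T ≃g T)
    (p : RealPoint T) : RealPoint T where
  weight := p.weight.equivMapDomain g.toEquiv
  nonneg v := by
    rw [Finsupp.equivMapDomain_apply]
    exact p.nonneg _
  total := by
    rw [Finsupp.sum_equivMapDomain]
    exact p.total
  simplex := by
    intro a ha b hb hab
    have ha' : g.symm a ∈ (p.weight.support : Set V) :=
      Finsupp.mem_support_iff.2 (Finsupp.mem_support_iff.1 (Finset.mem_coe.1 ha) :)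
    have hb' : g.symm b ∈ (p.weight.support : Set V) :=
      Finsupp.mem_support_iff.2 (Finsupp.mem_support_iff.1 (Finset.mem_coe.1 hb) :)
    exact g.symm.map_adj_iff.1 (p.simplex ha' hb' (fun h => hab (g.symm.injective h)))

open Classical in
/-- The path metric of the geometric realisation of a tree with edges of length `1`. Two points of
a common edge are compared in the coordinates of that edge. Otherwise the geodesic leaves (and
enters) the open edges of its ends through endpoints, so the distance is affine on either edge,
that is, the bilinear extension of the graph distance of the vertices. -/
noncomputable def RealPoint.dist {V : Type u} {T : SimpleGraph V} (p q : RealPoint T) : ℝ :=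
  if T.IsClique ((p.weight.support ∪ q.weight.support : Finset V) : Set V) then
    (∑ v ∈ p.weight.support ∪ q.weight.support, |p.weight v - q.weight v|) / 2
  else
    ∑ u ∈ p.weight.support, ∑ v ∈ q.weight.support, p.weight u * q.weight v * (T.dist u v : ℝ)

/-- The translation length `l(g)`: the least displacement `d(w, g w)` of a point `w` of the
geometric realisation. -/
noncomputable def translationLength {V : Type u} {T : SimpleGraph V} (g : T ≃g T) : ℝ :=
  sInf (Set.range fun w : RealPoint T => w.dist (w.map g))

/-- An automorphism is hyperbolic if its translation length is positive (and elliptic if it is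
`0`; inversions of edges are elliptic). -/
def IsHyperbolic {V : Type u} {T : SimpleGraph V} (g : T ≃g T) : Prop :=
  0 < translationLength g

/-- A group of automorphisms is purely hyperbolic if its nontrivial elements are hyperbolic. -/
def IsPurelyHyperbolic {V : Type u} {T : SimpleGraph V} (G : Subgroup (T ≃g T)) : Prop :=
  ∀ g ∈ G, g ≠ 1 → IsHyperbolic g

/-! ### Algorithms on automorphisms of trees

The input of an algorithm is a tuple `x₀, …, xₙ₋₁` of automorphisms of a tree together with one
more automorphism `g`. Automorphisms are infinite objects, so the algorithm gets them as black
boxes: it may form products and inverses of the automorphisms that it holds, test whether two of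
them are equal, and determine the distance by which they move the base vertex. Everything that it
can hold is then (the value of) a word in `x₀, …, xₙ₋₁, g`. -/

/-- Words in the input automorphisms: `some i` stands for `xᵢ` and `none` for `g`; the Boolean is
the sign of the exponent (`true` for `1` and `false` for `-1`). -/
abbrev InputWord : Type := List (Option ℕ × Bool)

/-- Words in the generators `x₀, x₁, …`. -/
abbrev GenWord : Type := List (ℕ × Bool)

/-- The value of a letter; an index out of range denotes the identity. -/
def letterValue {H : Type u} [Group H] {n : ℕ} (x : Fin n → H) (g : H) : Option ℕ → H
  | none => g
  | some i => if h : i < n then x ⟨i, h⟩ else 1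

/-- The automorphism that a word in the input denotes. -/
def wordValue {H : Type u} [Group H] {n : ℕ} (x : Fin n → H) (g : H) (w : InputWord) : H :=
  FreeGroup.lift (letterValue x g) (FreeGroup.mk w)

open Classical in
/-- The answer to a query `w`, where the word `w` denotes `h`: whether `h = 1`, and the length
`d(v₀, h v₀)`. -/
noncomputable def answer {V : Type u} {T : SimpleGraph V} (v₀ : V) {n : ℕ} (x : Fin n → (T ≃g T))
    (g : T ≃g T) (w : InputWord) : Bool × ℕ :=
  (decide (wordValue x g w = 1), T.dist v₀ (wordValue x g w v₀))

/-- An algorithm: a partial recursive function that computes, from the number `n` of generators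
and the answers to all earlier queries, either the next query or the final output. The output
`none` means that `g` is not in the subgroup, and `some w` that `g` is the value of `w`. -/
structure Algorithm where
  /-- the next move -/
  step : ℕ × List (Bool × ℕ) →. InputWord ⊕ Option GenWord
  partrec : Partrec step

/-- `A.Outputs n ans hist out`: run on `n` generators with queries answered by `ans`, the algorithm
`A`, having received the answers `hist` so far, halts with the output `out`. -/
inductive Algorithm.Outputs (A : Algorithm) (n : ℕ) (ans : InputWord → Bool × ℕ) :
    List (Bool × ℕ) → Option GenWord → Prop
  | halt {hist : List (Bool × ℕ)} {out : Option GenWord} :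
      Sum.inr out ∈ A.step (n, hist) → A.Outputs n ans hist out
  | ask {hist : List (Bool × ℕ)} {w : InputWord} {out : Option GenWord} :
      Sum.inl w ∈ A.step (n, hist) → A.Outputs n ans (hist ++ [ans w]) out →
      A.Outputs n ans hist out

/-- The algorithm `A` solves the constructive membership problem for the subgroup `G` of `Aut(T)`
with the specified generators `x`: on every `g` in `Aut(T)` it halts, it reports whether `g` is in
`G`, and if so its output is a word in the generators that represents `g`. -/
def Algorithm.SolvesConstructiveMembership (A : Algorithm) {V : Type u} {T : SimpleGraph V}
    (v₀ : V) (G : Subgroup (T ≃g T)) {n : ℕ} (x : Fin n → (T ≃g T)) : Prop :=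
  ∀ g : T ≃g T,
    (g ∈ G → ∃ w : List (Fin n × Bool), FreeGroup.lift x (FreeGroup.mk w) = g ∧
      A.Outputs n (answer v₀ x g) [] (some (w.map fun a => (a.1.val, a.2)))) ∧
    (g ∉ G → A.Outputs n (answer v₀ x g) [] none)

end TreeMembership

/-! Write |h| for `displacement v₀ h`. Membership is certified by a word equal to `g`.
Non-membership is certified by a finite set S, with a bound R ≥ |g|, which contains 1, the
generators and their inverses, has |s| ≤ R throughout, is closed under those products st with |st| ≤
R, and misses `g`.

Such a set refutes membership because it contains every h in the group with |h| ≤ R. Write h as a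
product of elements of S. Where the displacements of the partial products reach a peak, the
four-point inequality bounds the product of the two adjacent factors by R, so it lies in S and the
peak can be cut off (`displacement_mul_le_of_peak`). What remains is an ascending product; its
partial products have displacement at most R, hence lie in S one after another. This holds for every
group acting on a tree.

Pure hyperbolicity provides the finite set: vertex stabilisers are trivial, so the translates of
geodesics from `v₀` to the points `x v₀` form a locally finite subgraph. The orbit of `v₀` lies in
one component of it, whose paths are geodesics of the tree. So balls in the group are finite
(`IsPurelyHyperbolic.finite_displacement_le`), and a ball is a valid S.

The algorithm queries all words in turn and tries every certificate infinitely often against the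
answers so far. -/

namespace TreeMembership

/-! ### The four-point inequality in a tree -/

section Tree

variable {V : Type u} {T : SimpleGraph V}

/-- In a tree, at most one neighbour of a vertex is closer to a given vertex. -/
theorem eq_of_adj_of_dist_lt (hT : T.IsTree) {c u a b : V} (ha : T.Adj a u) (hb : T.Adj b u)
    (hda : T.dist c a < T.dist c u) (hdb : T.dist c b < T.dist c u) : a = b := by
  have key : ∀ {a : V}, T.Adj a u → T.dist c a < T.dist c u →
      ∃ p : T.Walk c u, p.IsPath ∧ p.penultimate = a := by
    intro a ha hda
    obtain ⟨p, hp⟩ := hT.connected.exists_walk_length_eq_dist c a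
    refine ⟨p.concat ha, ?_, by simp⟩
    apply SimpleGraph.Walk.isPath_of_length_eq_dist
    have h1 := SimpleGraph.dist_le (p.concat ha)
    rw [SimpleGraph.Walk.length_concat] at h1 ⊢
    omega
  obtain ⟨p, hp, rfl⟩ := key ha hda
  obtain ⟨q, hq, rfl⟩ := key hb hdb
  rw [(hT.existsUnique_path c u).unique hp hq]

theorem exists_adj_dist_add_one (hT : T.IsTree) {a b : V} (hab : a ≠ b) :
    ∃ a', T.Adj a a' ∧ T.dist a' b + 1 = T.dist a b := by
  obtain ⟨p, hp⟩ := hT.connected.exists_walk_length_eq_dist a b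
  cases p with
  | nil => exact absurd rfl hab
  | cons h p =>
    refine ⟨_, h, ?_⟩
    have h1 := SimpleGraph.dist_le p
    rw [SimpleGraph.Walk.length_cons] at hp
    have h2 := hT.connected.dist_triangle (u := a) (v := _) (w := b) |>.trans
      (Nat.add_le_add_right (SimpleGraph.dist_eq_one_iff_adj.2 h).le _)
    omega

/-- Geodesics on the two sides of an edge of a tree concatenate to a geodesic. -/
theorem dist_eq_add_of_separated (hT : T.IsTree) {b c : V} :
    ∀ (k : ℕ) {a a' : V}, T.dist a' b = k → T.Adj a a' → T.dist a b = k + 1 →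
      T.dist c a' = T.dist c a + 1 → T.dist c b = T.dist c a + T.dist a b := by
  intro k
  induction k with
  | zero =>
    intro a a' h0 h hab hc
    obtain rfl := hT.connected.dist_eq_zero_iff.1 h0
    omega
  | succ k ih =>
    intro a a' h0 h hab hc
    have hne : a' ≠ b := by
      rintro rfl
      simp at h0
    obtain ⟨a'', h', hd⟩ := exists_adj_dist_add_one hT hne
    have hd' : T.dist a'' b = k := by omega
    -- If `a''` were nearer to `c` than `a'`, it would equal `a`, the other neighbour of `a'` nearer
    -- to `c`; but `a''` is nearer to `b` than `a` is.
    rcases hT.dist_eq_dist_add_one_of_adj c h' with h1 | h1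
    · have := eq_of_adj_of_dist_lt hT (c := c) h h'.symm (by omega) (by omega)
      subst this
      omega
    · have := ih hd' h' h0 h1
      omega

/-- The four-point inequality. -/
theorem dist_add_dist_le_max (hT : T.IsTree) {b c d : V} :
    ∀ (k : ℕ) {a : V}, T.dist a b = k →
      T.dist a b + T.dist c d ≤ max (T.dist c a + T.dist d b) (T.dist d a + T.dist c b) := by
  intro k
  induction k with
  | zero =>
    intro a h0
    obtain rfl := hT.connected.dist_eq_zero_iff.1 h0
    have := hT.connected.dist_triangle (u := c) (v := a) (w := d)
    have := T.dist_comm (u := a) (v := d)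
    omega
  | succ k ih =>
    intro a h0
    have hne : a ≠ b := by
      rintro rfl
      simp at h0
    obtain ⟨a', h, hd⟩ := exists_adj_dist_add_one hT hne
    have hd' : T.dist a' b = k := by omega
    have hih := ih hd'
    -- If the step from `a` to `a'` approaches both `c` and `d`, both sides of the inequality drop
    -- by one. Otherwise the geodesic to `b` from one of `c`, `d` passes through `a`, and the
    -- triangle inequality for `c`, `a`, `d` suffices.
    rcases hT.dist_eq_dist_add_one_of_adj c h with h1 | h1
    · rcases hT.dist_eq_dist_add_one_of_adj d h with h2 | h2
      · omega
      · have h3 := dist_eq_add_of_separated hT k hd' h h0 h2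
        have := hT.connected.dist_triangle (u := c) (v := a) (w := d)
        have := T.dist_comm (u := a) (v := d)
        omega
    · have h3 := dist_eq_add_of_separated hT k hd' h h0 h1
      have := hT.connected.dist_triangle (u := c) (v := a) (w := d)
      have := T.dist_comm (u := a) (v := d)
      omega

theorem dist_map_iso (g : T ≃g T) (a b : V) : T.dist (g a) (g b) = T.dist a b := by
  have key : ∀ (g : T ≃g T) (a b : V), T.edist (g a) (g b) ≤ T.edist a b := by
    intro g a b
    refine le_iInf fun p => ?_
    simpa using SimpleGraph.edist_le (p.map g.toHom)
  have : T.edist (g a) (g b) = T.edist a b := by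
    refine le_antisymm (key g a b) ?_
    simpa using key g.symm (g a) (g b)
  rw [SimpleGraph.dist, this, SimpleGraph.dist]

/-! ### Peak reduction -/

/-- The displacement of the base vertex. -/
noncomputable def displacement (v₀ : V) (h : T ≃g T) : ℕ := T.dist v₀ (h v₀)

@[simp]
theorem displacement_one (v₀ : V) : displacement v₀ (1 : T ≃g T) = 0 := by
  simp [displacement]

theorem dist_apply_mul (v₀ : V) (h k : T ≃g T) :
    T.dist (h v₀) ((h * k) v₀) = displacement v₀ k := by
  rw [RelIso.mul_apply, dist_map_iso, displacement]

theorem displacement_inv (v₀ : V) (h : T ≃g T) : displacement v₀ h⁻¹ = displacement v₀ h := by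
  rw [← dist_apply_mul v₀ h h⁻¹, mul_inv_cancel, T.dist_comm]
  rfl

/-- If the path `v₀, b v₀, b s v₀, b s t v₀` has a peak at `b s v₀`, then cutting it off does not
need a longer step. -/
theorem displacement_mul_le_of_peak (hT : T.IsTree) {v₀ : V} {R : ℕ} {b s t : T ≃g T}
    (hs : displacement v₀ s ≤ R) (ht : displacement v₀ t ≤ R)
    (hb : displacement v₀ b ≤ displacement v₀ (b * s))
    (hbst : displacement v₀ (b * s * t) ≤ displacement v₀ (b * s)) :
    displacement v₀ (s * t) ≤ R := by
  -- This reads |bs| + |st| ≤ max (|b| + |t|) (|bst| + |s|); the peak at `b * s` leaves |st| ≤ max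
  -- |t| |s|.
  have h := dist_add_dist_le_max hT (a := v₀) (b := (b * s) v₀) (c := b v₀)
    (d := (b * s * t) v₀) _ rfl
  have h1 := dist_apply_mul v₀ b s
  have h2 := dist_apply_mul v₀ (b * s) t
  have h3 := dist_apply_mul v₀ b (s * t)
  rw [← mul_assoc] at h3
  have h4 := T.dist_comm (u := b v₀) (v := v₀)
  have h5 := T.dist_comm (u := (b * s * t) v₀) (v := v₀)
  have h6 := T.dist_comm (u := (b * s * t) v₀) (v := (b * s) v₀)
  simp only [displacement] at *
  omega

/-- Products of elements of `S` in which each factor after the first increases the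
displacement. -/
inductive Ascending (v₀ : V) (S : Set (T ≃g T)) : (T ≃g T) → Prop
  | base {s : T ≃g T} : s ∈ S → Ascending v₀ S s
  | step {b s : T ≃g T} : Ascending v₀ S b → s ∈ S →
      displacement v₀ b < displacement v₀ (b * s) → Ascending v₀ S (b * s)

/-- `S` contains all products of two of its elements with displacement at most `R`, and the
displacements of its elements are at most `R`. -/
structure IsBoundedClosed (v₀ : V) (S : Set (T ≃g T)) (R : ℕ) : Prop where
  le : ∀ s ∈ S, displacement v₀ s ≤ R
  mul_mem : ∀ s ∈ S, ∀ t ∈ S, displacement v₀ (s * t) ≤ R → s * t ∈ S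

/-- If `s` does not ascend after the last factor `t`, the path has a peak there, so `t * s` is in
`S` and can be treated as one factor after a shorter product. -/
theorem Ascending.mul (hT : T.IsTree) {v₀ : V} {S : Set (T ≃g T)} {R : ℕ}
    (hS : IsBoundedClosed v₀ S R) {b : T ≃g T} (hb : Ascending v₀ S b) :
    ∀ {s : T ≃g T}, s ∈ S → Ascending v₀ S (b * s) := by
  induction hb with
  | @base b hb =>
    intro s hs
    by_cases h : displacement v₀ b < displacement v₀ (b * s)
    · exact .step (.base hb) hs h
    · exact .base (hS.mul_mem b hb s hs ((not_lt.1 h).trans (hS.le b hb)))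
  | @step b t hb ht hlt ih =>
    intro s hs
    by_cases h : displacement v₀ (b * t) < displacement v₀ (b * t * s)
    · exact .step (.step hb ht hlt) hs h
    · rw [mul_assoc]
      exact ih (hS.mul_mem t ht s hs (displacement_mul_le_of_peak hT (hS.le t ht) (hS.le s hs)
        hlt.le (not_lt.1 h)))

/-- Displacements grow along an ascending product, so all its partial products inherit the bound
`R`, and closure applies to each in turn. -/
theorem Ascending.mem {v₀ : V} {S : Set (T ≃g T)} {R : ℕ} (hS : IsBoundedClosed v₀ S R)
    {b : T ≃g T} (hb : Ascending v₀ S b) (hR : displacement v₀ b ≤ R) : b ∈ S := by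
  induction hb with
  | base hb => exact hb
  | @step b t _ ht hlt ih => exact hS.mul_mem b (ih (hlt.le.trans hR)) t ht hR

/-- A bounded closed set that contains generators of a group, their inverses and `1` contains all
elements of the group of displacement at most `R`. -/
theorem IsBoundedClosed.mem_of_displacement_le (hT : T.IsTree) {v₀ : V} {S : Set (T ≃g T)} {R : ℕ}
    (hS : IsBoundedClosed v₀ S R) (h1 : 1 ∈ S) {X : Set (T ≃g T)} (hX : ∀ x ∈ X, x ∈ S)
    (hX' : ∀ x ∈ X, x⁻¹ ∈ S) {h : T ≃g T} (hh : h ∈ Subgroup.closure X)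
    (hR : displacement v₀ h ≤ R) : h ∈ S := by
  suffices Ascending v₀ S h from this.mem hS hR
  clear hR
  induction hh using Subgroup.closure_induction_right with
  | one => exact .base h1
  | mul_right a _ b hb ih => exact ih.mul hT hS (hX b hb)
  | mul_inv_cancel a _ b hb ih => exact ih.mul hT hS (hX' b hb)

/-! ### Finiteness of balls in purely hyperbolic groups -/

theorem not_isHyperbolic_of_apply_eq {g : T ≃g T} {v : V} (h : g v = v) : ¬ IsHyperbolic g := by
  classical
  let p : RealPoint T :=
    { weight := Finsupp.single v 1
      nonneg := fun w => by
        rw [Finsupp.single_apply]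
        split_ifs <;> norm_num
      total := by simp
      simplex := by
        rw [Finsupp.support_single v one_ne_zero]
        simp }
  have hp : p.map g = p := by
    have : (p.map g).weight = p.weight := by
      simp [p, RealPoint.map, Finsupp.equivMapDomain_single, h]
    cases hq : p.map g
    simp_all [p]
  have h0 : p.dist (p.map g) = 0 := by
    rw [hp, RealPoint.dist, Finset.union_idempotent, if_pos p.simplex]
    simp
  rw [IsHyperbolic, translationLength, not_lt]
  -- A real infimum of a set unbounded below is 0 by convention, so nonnegativity of
  -- `RealPoint.dist` is not needed.
  by_cases hb : BddBelow (Set.range fun w : RealPoint T => w.dist (w.map g))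
  · exact csInf_le hb ⟨p, h0⟩
  · rw [Real.sInf_of_not_bddBelow hb]

/-- The action on vertices is free: `b⁻¹ * a` fixes `v`. -/
theorem IsPurelyHyperbolic.eq_of_apply_eq {G : Subgroup (T ≃g T)} (hG : IsPurelyHyperbolic G)
    {a b : T ≃g T} (ha : a ∈ G) (hb : b ∈ G) {v : V} (h : a v = b v) : a = b := by
  by_contra hne
  refine not_isHyperbolic_of_apply_eq (g := b⁻¹ * a) (v := v) ?_
    (hG _ (G.mul_mem (G.inv_mem hb) ha) fun h1 => hne (inv_mul_eq_one.1 h1).symm)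
  rw [RelIso.mul_apply, h]
  exact b.symm_apply_apply v

/-- The union of the `G`-translates of the edges in `E`. -/
def translates (G : Subgroup (T ≃g T)) (E : Set (V × V)) : SimpleGraph V :=
  SimpleGraph.fromRel fun a b => ∃ h ∈ G, ∃ e ∈ E, h e.1 = a ∧ h e.2 = b

theorem translates_adj {G : Subgroup (T ≃g T)} {E : Set (V × V)} {a b : V}
    (h : (translates G E).Adj a b) : ∃ h ∈ G, ∃ e ∈ E ∪ Prod.swap '' E, h e.1 = a ∧ h e.2 = b := by
  rw [translates, SimpleGraph.fromRel_adj] at h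
  obtain ⟨-, ⟨h, hh, e, he, h1, h2⟩ | ⟨h, hh, e, he, h1, h2⟩⟩ := h
  · exact ⟨h, hh, e, .inl he, h1, h2⟩
  · exact ⟨h, hh, e.swap, .inr ⟨e, he, rfl⟩, h2, h1⟩

theorem finite_neighborSet_translates {G : Subgroup (T ≃g T)} (hG : IsPurelyHyperbolic G)
    {E : Set (V × V)} (hE : E.Finite) (a : V) : ((translates G E).neighborSet a).Finite := by
  classical
  have hF : (E ∪ Prod.swap '' E).Finite := hE.union (hE.image _)
  -- By freeness, each oriented edge `e` has at most one translate starting at `a`, so `e` accounts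
  -- for at most one neighbour.
  refine (hF.image fun e => if h : ∃ h ∈ G, h e.1 = a then h.choose e.2 else a).subset ?_
  intro b hb
  obtain ⟨h, hh, e, he, h1, h2⟩ := translates_adj hb
  have hex : ∃ h ∈ G, h e.1 = a := ⟨h, hh, h1⟩
  refine ⟨e, he, ?_⟩
  simp only [dif_pos hex]
  rw [hG.eq_of_apply_eq hex.choose_spec.1 hh (hex.choose_spec.2.trans h1.symm), h2]

theorem finite_setOf_walk_length_le {Y : SimpleGraph V} (hY : ∀ a, (Y.neighborSet a).Finite)
    (R : ℕ) : ∀ a : V, {b | ∃ p : Y.Walk a b, p.length ≤ R}.Finite := by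
  induction R with
  | zero =>
    intro a
    refine (Set.finite_singleton a).subset ?_
    rintro b ⟨p, hp⟩
    exact (SimpleGraph.Walk.eq_of_length_eq_zero (Nat.le_zero.1 hp)).symm
  | succ R ih =>
    intro a
    refine ((Set.finite_singleton a).union ((hY a).biUnion fun c _ => ih c)).subset ?_
    rintro b ⟨p, hp⟩
    cases p with
    | nil => exact .inl rfl
    | @cons _ c _ h p =>
      refine .inr (Set.mem_biUnion h ⟨p, ?_⟩)
      simpa using hp

theorem reachable_translates {G : Subgroup (T ≃g T)} {E : Set (V × V)} {h : T ≃g T} (hh : h ∈ G)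
    {a b : V} (p : T.Walk a b) (hp : ∀ d ∈ p.darts, d.toProd ∈ E) :
    (translates G E).Reachable (h a) (h b) := by
  induction p with
  | nil => exact .refl _
  | @cons a c b hac p ih =>
    refine .trans (SimpleGraph.Adj.reachable ?_) (ih fun d hd => hp d (by simp [hd]))
    rw [translates, SimpleGraph.fromRel_adj]
    exact ⟨fun h' => hac.ne (h.injective h'),
      .inl ⟨h, hh, (a, c), hp ⟨(a, c), hac⟩ (by simp), rfl, rfl⟩⟩

theorem translates_le {G : Subgroup (T ≃g T)} {E : Set (V × V)} (hE : ∀ e ∈ E, T.Adj e.1 e.2) :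
    translates G E ≤ T := by
  intro a b hab
  rw [translates, SimpleGraph.fromRel_adj] at hab
  obtain ⟨-, ⟨h, -, e, he, rfl, rfl⟩ | ⟨h, -, e, he, rfl, rfl⟩⟩ := hab
  · exact h.map_adj_iff.2 (hE e he)
  · exact (h.map_adj_iff.2 (hE e he)).symm

/-- A finitely generated purely hyperbolic group has finitely many elements of bounded
displacement. -/
theorem IsPurelyHyperbolic.finite_displacement_le (hT : T.IsTree) {X : Set (T ≃g T)}
    (hX : X.Finite) (hG : IsPurelyHyperbolic (Subgroup.closure X)) (v₀ : V) (R : ℕ) :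
    {h | h ∈ Subgroup.closure X ∧ displacement v₀ h ≤ R}.Finite := by
  classical
  set G := Subgroup.closure X with hGdef
  choose p _ using fun x : T ≃g T => hT.connected.exists_walk_length_eq_dist v₀ (x v₀)
  let E : Set (V × V) := ⋃ x ∈ X, {e | e ∈ (p x).darts.map (·.toProd)}
  have hE : E.Finite := hX.biUnion fun x _ => List.finite_toSet _
  have hEadj : ∀ e ∈ E, T.Adj e.1 e.2 := by
    intro e he
    simp only [E, Set.mem_iUnion, Set.mem_ofPred_eq, List.mem_map] at he
    obtain ⟨x, _, d, _, rfl⟩ := he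
    exact d.adj
  have hstep : ∀ h ∈ G, ∀ x ∈ X, (translates G E).Reachable (h v₀) (h (x v₀)) := by
    intro h hh x hx
    refine reachable_translates hh (p x) fun d hd => ?_
    exact Set.mem_biUnion hx (List.mem_map.2 ⟨d, hd, rfl⟩)
  have hreach : ∀ h ∈ G, (translates G E).Reachable v₀ (h v₀) := by
    intro h hh
    induction hh using Subgroup.closure_induction_right with
    | one => exact .refl _
    | mul_right a ha b hb ih => exact ih.trans (hstep a ha b hb)
    | mul_inv_cancel a ha b hb ih =>
      refine ih.trans ?_
      have := hstep (a * b⁻¹) (G.mul_mem ha (G.inv_mem (Subgroup.subset_closure hb))) b hb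
      rw [← RelIso.mul_apply, inv_mul_cancel_right] at this
      exact this.symm
  have hfin := finite_setOf_walk_length_le (finite_neighborSet_translates hG hE) R v₀
  refine Set.Finite.of_finite_image (f := fun h : T ≃g T => h v₀) (hfin.subset ?_) ?_
  · rintro _ ⟨h, ⟨hh, hR⟩, rfl⟩
    obtain ⟨q⟩ := hreach h hh
    refine ⟨q.bypass, ?_⟩
    obtain ⟨r, hr, hrl⟩ := hT.connected.exists_path_of_dist v₀ (h v₀)
    -- A path in the subgraph is a path in the tree, hence the geodesic, so its length is the
    -- displacement.
    have hq : (q.bypass.mapLe (translates_le hEadj)).IsPath :=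
      (q.bypass_isPath).mapLe (translates_le hEadj)
    have := congrArg SimpleGraph.Walk.length ((hT.existsUnique_path _ _).unique hq hr)
    simp only [SimpleGraph.Walk.length_map] at this
    rw [displacement] at hR
    omega
  · intro a ha b hb hab
    exact hG.eq_of_apply_eq ha.1 hb.1 hab

end Tree

open Encodable

/-! ### Words -/

/-- The word for `u⁻¹ w`. -/
def leftDiv (u w : InputWord) : InputWord := FreeGroup.invRev u ++ w

/-- A word in the generators as a word in the input. -/
def GenWord.toInput (w : GenWord) : InputWord := w.map fun a => (some a.1, a.2)

section Words

variable {H : Type u} [Group H] {n : ℕ} (x : Fin n → H) (g : H)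

theorem wordValue_append (u w : InputWord) :
    wordValue x g (u ++ w) = wordValue x g u * wordValue x g w := by
  rw [wordValue, ← FreeGroup.mul_mk, map_mul, wordValue, wordValue]

theorem wordValue_leftDiv (u w : InputWord) :
    wordValue x g (leftDiv u w) = (wordValue x g u)⁻¹ * wordValue x g w := by
  rw [leftDiv, wordValue_append, wordValue, ← FreeGroup.inv_mk, map_inv]
  rfl

theorem wordValue_leftDiv_eq_one {u w : InputWord} :
    wordValue x g (leftDiv u w) = 1 ↔ wordValue x g u = wordValue x g w := by
  rw [wordValue_leftDiv, inv_mul_eq_one]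

@[simp]
theorem wordValue_nil : wordValue x g [] = 1 := by
  simp [wordValue]

@[simp]
theorem wordValue_last : wordValue x g [(none, true)] = g := by
  simp [wordValue, letterValue]

@[simp]
theorem wordValue_generator (i : Fin n) : wordValue x g [(some i.val, true)] = x i := by
  simp [wordValue, letterValue]

@[simp]
theorem wordValue_generator_inv (i : Fin n) : wordValue x g [(some i.val, false)] = (x i)⁻¹ := by
  simp [wordValue, letterValue]

theorem wordValue_toInput (w : List (Fin n × Bool)) :
    wordValue x g (GenWord.toInput (w.map fun a => (a.1.val, a.2))) =
      FreeGroup.lift x (FreeGroup.mk w) := by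
  simp [wordValue, GenWord.toInput, letterValue, Function.comp_def]

theorem exists_word_of_mem_closure {h : H} (hh : h ∈ Subgroup.closure (Set.range x)) :
    ∃ w : List (Fin n × Bool), FreeGroup.lift x (FreeGroup.mk w) = h := by
  rw [← FreeGroup.range_lift_eq_closure] at hh
  obtain ⟨a, rfl⟩ := hh
  exact ⟨a.toWord, by rw [FreeGroup.mk_toWord]⟩

end Words

theorem GenWord.exists_eq_map {n : ℕ} (w : GenWord) (hw : ∀ a ∈ w, a.1 < n) :
    ∃ w' : List (Fin n × Bool), w = w'.map fun a => (a.1.val, a.2) := by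
  induction w with
  | nil => exact ⟨[], rfl⟩
  | cons a w ih =>
    obtain ⟨w', rfl⟩ := ih fun b hb => hw b (List.mem_cons_of_mem _ hb)
    exact ⟨(⟨a.1, hw a List.mem_cons_self⟩, a.2) :: w', rfl⟩

/-! ### Certificates -/

/-- The answer to the query `w`, if all words are queried in the order of their codes. -/
def lookup (h : List (Bool × ℕ)) (w : InputWord) : Bool × ℕ := h.getD (encode w) (false, 0)

/-- The query `w` has been answered. -/
def IsKnown (h : List (Bool × ℕ)) (w : InputWord) : Prop := encode w < h.length

/-- A candidate for a proof that `g` is in the group (the last component, a word for `g`), or that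
it is not (the first two components: words for all elements with displacement at most some bound,
and the bound). -/
abbrev Certificate : Type := List InputWord × ℕ × GenWord

/-- The number of generators, the answers so far, and a certificate. -/
abbrev Context : Type := (ℕ × List (Bool × ℕ)) × Certificate

/-- The answers show that the word of the certificate represents `g`. -/
def Confirms (e : Context) : Prop :=
  (∀ a ∈ e.2.2.2, a.1 < e.1.1) ∧
    (lookup e.1.2 (leftDiv (GenWord.toInput e.2.2.2) [(none, true)])).1 = true

/-- The list contains the empty word, the generators and their inverses. -/
def ContainsGenerators (e : Context) : Prop :=
  [] ∈ e.2.1 ∧ ∀ i < e.1.1, [(some i, true)] ∈ e.2.1 ∧ [(some i, false)] ∈ e.2.1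

/-- The answers show that `w` has displacement at most the bound. -/
def ShowsLe (w : InputWord) (e : Context) : Prop :=
  IsKnown e.1.2 w ∧ (lookup e.1.2 w).2 ≤ e.2.2.1

/-- The answers show that `s t` has displacement above the bound or is in the list. -/
def ShowsMul (s t : InputWord) (e : Context) : Prop :=
  e.2.2.1 < (lookup e.1.2 (s ++ t)).2 ∨
    ∃ u ∈ e.2.1, (lookup e.1.2 (leftDiv u (s ++ t))).1 = true

/-- The answers show that `u` does not represent `g`. -/
def ShowsNe (u : InputWord) (e : Context) : Prop :=
  IsKnown e.1.2 (leftDiv u [(none, true)]) ∧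
    (lookup e.1.2 (leftDiv u [(none, true)])).1 = false

/-- The answers show that the list is closed under products within the bound, and that `g` is
within the bound, but not in the list. -/
def Refutes (e : Context) : Prop :=
  ContainsGenerators e ∧ (∀ s ∈ e.2.1, ShowsLe s e) ∧
    (∀ s ∈ e.2.1, ∀ t ∈ e.2.1, ShowsMul s t e) ∧
    ShowsLe [(none, true)] e ∧ ∀ u ∈ e.2.1, ShowsNe u e

/-! ### Computability of the check -/

section Primrec

theorem primrec_invRev : Primrec (FreeGroup.invRev : InputWord → InputWord) :=
  Primrec.list_reverse.comp <| Primrec.list_map .id <|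
    (Primrec.pair (Primrec.fst.comp Primrec.snd)
      (Primrec.not.comp (Primrec.snd.comp Primrec.snd))).to₂

theorem primrec_leftDiv : Primrec₂ leftDiv :=
  Primrec.list_append.comp₂ (primrec_invRev.comp Primrec.fst).to₂ .right

theorem primrec_toInput : Primrec GenWord.toInput :=
  Primrec.list_map .id <|
    (Primrec.pair (Primrec.option_some.comp (Primrec.fst.comp Primrec.snd))
      (Primrec.snd.comp Primrec.snd)).to₂

theorem primrec_lookup : Primrec₂ lookup :=
  (Primrec.list_getD (false, 0)).comp₂ .left (Primrec.encode.comp Primrec.snd).to₂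

variable {α : Type*} [Primcodable α]

theorem primrecPred_isKnown {h : α → List (Bool × ℕ)} {w : α → InputWord} (hh : Primrec h)
    (hw : Primrec w) : PrimrecPred fun a => IsKnown (h a) (w a) :=
  Primrec.nat_lt.comp (Primrec.encode.comp hw) (Primrec.list_length.comp hh)

theorem primrec_words : Primrec fun e : Context => e.2.1 := Primrec.fst.comp .snd

theorem primrec_bound : Primrec fun e : Context => e.2.2.1 :=
  Primrec.fst.comp (Primrec.snd.comp .snd)

theorem primrec_answers : Primrec fun e : Context => e.1.2 := Primrec.snd.comp .fst

theorem primrecRel_mem {β : Type*} [Primcodable β] :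
    PrimrecRel fun (b : β) (L : List β) => b ∈ L :=
  ((PrimrecRel.exists_mem_list (R := fun a b : β => a = b) Primrec.eq).comp
    (Primrec.snd) (Primrec.fst)).of_eq fun p => by simp

theorem primrecPred_confirms : PrimrecPred Confirms := by
  have hw : Primrec fun e : Context => e.2.2.2 := Primrec.snd.comp (Primrec.snd.comp .snd)
  refine PrimrecPred.and ?_ ?_
  · exact (PrimrecRel.forall_mem_list (R := fun (a : ℕ × Bool) (e : Context) => a.1 < e.1.1)
      (Primrec.nat_lt.comp (Primrec.fst.comp .fst)
        (Primrec.fst.comp (Primrec.fst.comp .snd)))).comp hw .id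
  · exact Primrec.eq.comp (Primrec.fst.comp (primrec_lookup.comp primrec_answers
      (primrec_leftDiv.comp (primrec_toInput.comp hw) (.const _)))) (.const _)

theorem primrecPred_containsGenerators : PrimrecPred ContainsGenerators := by
  have hmem : ∀ b : Bool,
      PrimrecRel fun (i : ℕ) (e : Context) => [(some i, b)] ∈ e.2.1 := fun b =>
    primrecRel_mem.comp (Primrec.list_cons.comp
      (Primrec.pair (Primrec.option_some.comp .fst) (.const b)) (.const []))
      (primrec_words.comp .snd)
  refine PrimrecPred.and (primrecRel_mem.comp (.const _) primrec_words) ?_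
  have h : PrimrecRel fun (i : ℕ) (e : Context) =>
      [(some i, true)] ∈ e.2.1 ∧ [(some i, false)] ∈ e.2.1 :=
    PrimrecPred.and (hmem true) (hmem false)
  exact (h.forall_mem_list.comp (Primrec.list_range.comp (Primrec.fst.comp .fst)) .id).of_eq
    fun e => by simp

theorem primrecRel_showsLe : PrimrecRel ShowsLe :=
  PrimrecPred.and (primrecPred_isKnown (primrec_answers.comp .snd) .fst)
    (Primrec.nat_le.comp
      (Primrec.snd.comp (primrec_lookup.comp (primrec_answers.comp .snd) .fst))
      (primrec_bound.comp .snd))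

theorem primrecRel_showsNe : PrimrecRel ShowsNe := by
  have h : Primrec fun p : InputWord × Context => leftDiv p.1 [(none, true)] :=
    primrec_leftDiv.comp .fst (.const _)
  exact PrimrecPred.and (primrecPred_isKnown (primrec_answers.comp .snd) h)
    (Primrec.eq.comp (Primrec.fst.comp (primrec_lookup.comp (primrec_answers.comp .snd) h))
      (.const _))

theorem primrecRel_showsMul :
    PrimrecRel fun (s : InputWord) (p : InputWord × Context) => ShowsMul s p.1 p.2 := by
  have happ : Primrec fun q : InputWord × InputWord × Context => q.1 ++ q.2.1 :=
    Primrec.list_append.comp .fst (Primrec.fst.comp .snd)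
  have he : Primrec fun q : InputWord × InputWord × Context => q.2.2 :=
    Primrec.snd.comp .snd
  refine PrimrecPred.or ?_ ?_
  · exact Primrec.nat_lt.comp (primrec_bound.comp he)
      (Primrec.snd.comp (primrec_lookup.comp (primrec_answers.comp he) happ))
  · exact (PrimrecRel.exists_mem_list
      (R := fun (u : InputWord) (q : InputWord × InputWord × Context) =>
        (lookup q.2.2.1.2 (leftDiv u (q.1 ++ q.2.1))).1 = true)
      (Primrec.eq.comp (Primrec.fst.comp (primrec_lookup.comp
        (primrec_answers.comp (he.comp .snd)) (primrec_leftDiv.comp .fst (happ.comp .snd))))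
        (.const _))).comp (primrec_words.comp he) .id

theorem primrecPred_refutes : PrimrecPred Refutes := by
  have hmul : PrimrecPred fun e : Context => ∀ s ∈ e.2.1, ∀ t ∈ e.2.1, ShowsMul s t e := by
    -- The quantifiers are swapped because `primrecRel_showsMul` has `s` as its leading variable.
    have h1 : PrimrecRel fun (t : InputWord) (e : Context) => ∀ s ∈ e.2.1, ShowsMul s t e :=
      primrecRel_showsMul.forall_mem_list.comp (primrec_words.comp .snd) .id
    exact (h1.forall_mem_list.comp primrec_words .id).of_eq fun e =>
      ⟨fun h s hs t ht => h t ht s hs, fun h t ht s hs => h s hs t ht⟩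
  exact primrecPred_containsGenerators.and <|
    (primrecRel_showsLe.forall_mem_list.comp primrec_words .id).and <|
    hmul.and <| (primrecRel_showsLe.comp (.const _) .id).and <|
    primrecRel_showsNe.forall_mem_list.comp primrec_words .id

end Primrec

/-! ### The algorithm -/

/-- The `k`-th query. -/
def query (k : ℕ) : InputWord := (decode k).getD []

/-- The certificate that is tried after `k` queries. -/
def certificate (k : ℕ) : Certificate := (decode k.unpair.1).getD ([], 0, [])

open Classical in
/-- After `k` queries, check the `k`-th certificate, and go on to the `k`-th query if it proves
nothing. -/
noncomputable def move (p : ℕ × List (Bool × ℕ)) : InputWord ⊕ Option GenWord :=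
  if Confirms (p, certificate p.2.length) then .inr (some (certificate p.2.length).2.2)
  else if Refutes (p, certificate p.2.length) then .inr none
  else .inl (query p.2.length)

theorem primrec_move : Primrec move := by
  have hlen : Primrec fun p : ℕ × List (Bool × ℕ) => p.2.length :=
    Primrec.list_length.comp .snd
  have hcert : Primrec fun p : ℕ × List (Bool × ℕ) => certificate p.2.length :=
    Primrec.option_getD.comp
      (Primrec.decode.comp (Primrec.fst.comp (Primrec.unpair.comp hlen))) (.const _)
  have hquery : Primrec fun p : ℕ × List (Bool × ℕ) => query p.2.length :=
    Primrec.option_getD.comp (Primrec.decode.comp hlen) (.const _)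
  classical
  exact Primrec.ite (primrecPred_confirms.comp (Primrec.pair .id hcert))
    (Primrec.sumInr.comp (Primrec.option_some.comp (Primrec.snd.comp (Primrec.snd.comp hcert))))
    (Primrec.ite (primrecPred_refutes.comp (Primrec.pair .id hcert)) (.const _)
      (Primrec.sumInl.comp hquery))

/-- Query all words until a certificate is found. -/
noncomputable def certificateSearch : Algorithm where
  step := fun p => Part.some (move p)
  partrec := primrec_move.to_comp

/-- The answers to the first `k` queries. -/
def history (ans : InputWord → Bool × ℕ) (k : ℕ) : List (Bool × ℕ) :=
  (List.range k).map fun i => ans (query i)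

section Search

variable {ans : InputWord → Bool × ℕ}

@[simp]
theorem length_history (k : ℕ) : (history ans k).length = k := by
  simp [history]

theorem query_encode (w : InputWord) : query (encode w) = w := by
  simp [query]

theorem lookup_history {k : ℕ} {w : InputWord} (h : encode w < k) :
    lookup (history ans k) w = ans w := by
  simp [lookup, history, List.getD_eq_getElem?_getD, h, query_encode]

theorem lookup_history_of_le {k : ℕ} {w : InputWord} (h : k ≤ encode w) :
    lookup (history ans k) w = (false, 0) := by
  simp [lookup, history, List.getD_eq_getElem?_getD, h]

/-- The default answer `(false, 0)` asserts neither an identity nor a lower bound on displacement,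
so these two kinds of evidence need no `IsKnown`; inequality and upper bounds do. -/
theorem eq_true_of_lookup {k : ℕ} {w : InputWord} (h : (lookup (history ans k) w).1 = true) :
    (ans w).1 = true := by
  rcases lt_or_ge (encode w) k with hk | hk
  · rwa [lookup_history hk] at h
  · simp [lookup_history_of_le hk] at h

theorem lt_of_lt_lookup {k R : ℕ} {w : InputWord} (h : R < (lookup (history ans k) w).2) :
    R < (ans w).2 := by
  rcases lt_or_ge (encode w) k with hk | hk
  · rwa [lookup_history hk] at h
  · simp [lookup_history_of_le hk] at h

/-- The run may stop before stage `j`; recording that its output is a move on a true history is what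
lets soundness apply. -/
theorem exists_outputs {n j : ℕ} (hj : (move (n, history ans j)).isRight) :
    ∃ out, certificateSearch.Outputs n ans [] out ∧
      ∃ k, move (n, history ans k) = .inr out := by
  suffices ∀ d k, k + d = j → ∃ out, certificateSearch.Outputs n ans (history ans k) out ∧
      ∃ k, move (n, history ans k) = .inr out from this j 0 (Nat.zero_add j)
  have hhalt : ∀ k, (move (n, history ans k)).isRight →
      ∃ out, certificateSearch.Outputs n ans (history ans k) out ∧
        ∃ k, move (n, history ans k) = .inr out := by
    intro k hk
    obtain ⟨out, hout⟩ := Sum.isRight_iff.1 hk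
    exact ⟨out, .halt (Part.mem_some_iff.2 hout.symm), k, hout⟩
  intro d
  induction d with
  | zero =>
    rintro k rfl
    exact hhalt k hj
  | succ d ih =>
    intro k hk
    by_cases hr : (move (n, history ans k)).isRight
    · exact hhalt k hr
    · obtain ⟨out, hout, h⟩ := ih (k + 1) (by omega)
      refine ⟨out, .ask (w := query k) (Part.mem_some_iff.2 ?_) ?_, h⟩
      · rw [move] at hr ⊢
        split_ifs at hr ⊢ <;> simp_all
      · rwa [history, List.range_succ, List.map_append] at hout

end Search

/-! ### Correctness -/

section Correctness

variable {V : Type u} {T : SimpleGraph V} {v₀ : V} {n : ℕ} {x : Fin n → (T ≃g T)} {g : T ≃g T}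

theorem answer_fst {w : InputWord} :
    (answer v₀ x g w).1 = true ↔ wordValue x g w = 1 := by
  simp [answer]

theorem answer_snd {w : InputWord} :
    (answer v₀ x g w).2 = displacement v₀ (wordValue x g w) := rfl

theorem Confirms.exists_word {k : ℕ} {c : Certificate}
    (h : Confirms ((n, history (answer v₀ x g) k), c)) :
    ∃ w : List (Fin n × Bool), FreeGroup.lift x (FreeGroup.mk w) = g ∧
      c.2.2 = w.map fun a => (a.1.val, a.2) := by
  obtain ⟨w, hw⟩ := GenWord.exists_eq_map c.2.2 h.1
  refine ⟨w, ?_, hw⟩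
  have := answer_fst.1 (eq_true_of_lookup h.2)
  rw [wordValue_leftDiv_eq_one, wordValue_last] at this
  simp only [hw] at this
  rwa [wordValue_toInput] at this

theorem ShowsLe.displacement_le {k : ℕ} {c : Certificate} {w : InputWord}
    (h : ShowsLe w ((n, history (answer v₀ x g) k), c)) :
    displacement v₀ (wordValue x g w) ≤ c.2.1 := by
  have h1 : encode w < k := by simpa [IsKnown] using h.1
  simpa only [lookup_history h1, answer_snd] using h.2

/-- The values of the listed words form a bounded closed set, which would have to contain `g`. -/
theorem Refutes.notMem (hT : T.IsTree) {k : ℕ} {c : Certificate}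
    (h : Refutes ((n, history (answer v₀ x g) k), c)) : g ∉ Subgroup.closure (Set.range x) := by
  obtain ⟨hgen, hle, hmul, hgle, hne⟩ := h
  intro hg
  have hS : IsBoundedClosed v₀ {a | ∃ s ∈ c.1, wordValue x g s = a} c.2.1 := by
    constructor
    · rintro _ ⟨s, hs, rfl⟩
      exact (hle s hs).displacement_le
    · rintro _ ⟨s, hs, rfl⟩ _ ⟨t, ht, rfl⟩ hst
      rw [← wordValue_append] at hst ⊢
      rcases hmul s hs t ht with h | ⟨u, hu, h⟩
      · exact absurd (lt_of_lt_lookup h) (by rw [answer_snd]; exact hst.not_gt)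
      · exact ⟨u, hu, (wordValue_leftDiv_eq_one x g).1 (answer_fst.1 (eq_true_of_lookup h))⟩
  have hmem := hS.mem_of_displacement_le hT ⟨[], hgen.1, wordValue_nil x g⟩
    (by rintro _ ⟨i, rfl⟩
        exact ⟨_, (hgen.2 i i.2).1, wordValue_generator x g i⟩)
    (by rintro _ ⟨i, rfl⟩
        exact ⟨_, (hgen.2 i i.2).2, wordValue_generator_inv x g i⟩) hg
    (by simpa using hgle.displacement_le)
  obtain ⟨u, hu, hug⟩ := hmem
  obtain ⟨hk, hf⟩ := hne u hu
  have hk : encode (leftDiv u [(none, true)]) < k := by simpa [IsKnown] using hk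
  have : (answer v₀ x g (leftDiv u [(none, true)])).1 = true := by
    rw [answer_fst, wordValue_leftDiv_eq_one, wordValue_last, hug]
  simp only [lookup_history hk, this] at hf
  exact absurd hf (by decide)

/-- A certificate is tried after arbitrarily many queries. -/
theorem exists_certificate_eq (c : Certificate) (m : ℕ) : ∃ k, m ≤ k ∧ certificate k = c :=
  -- The second component is padding that `certificate` ignores; it pushes `k` past `m`.
  ⟨Nat.pair (encode c) m, Nat.right_le_pair _ _, by simp [certificate]⟩

theorem exists_confirms (hg : g ∈ Subgroup.closure (Set.range x)) :
    ∃ k, Confirms ((n, history (answer v₀ x g) k), certificate k) := by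
  obtain ⟨w, hw⟩ := exists_word_of_mem_closure x hg
  let w' : GenWord := w.map fun a => (a.1.val, a.2)
  obtain ⟨k, hk, hc⟩ := exists_certificate_eq ([], 0, w')
    (encode (leftDiv w'.toInput [(none, true)]) + 1)
  refine ⟨k, ?_, ?_⟩
  · rw [hc]
    intro a ha
    obtain ⟨b, -, rfl⟩ := List.mem_map.1 ha
    exact b.1.2
  · rw [hc]
    simp only
    rw [lookup_history hk, answer_fst, wordValue_leftDiv_eq_one, wordValue_last, wordValue_toInput,
      hw]

theorem exists_forall_mem_lt {α : Type*} (L : List α) (f : α → ℕ) : ∃ m, ∀ a ∈ L, f a < m :=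
  ⟨(L.map f).sum + 1, fun _ ha => Nat.lt_succ_of_le (List.le_sum_of_mem (List.mem_map_of_mem ha))⟩

/-- A list of words for all elements of displacement at most `R` that contains the obvious words
for the generators and their inverses. -/
theorem exists_words (hT : T.IsTree) (hG : IsPurelyHyperbolic (Subgroup.closure (Set.range x)))
    (g : T ≃g T) {R : ℕ} (hR : ∀ i, displacement v₀ (x i) ≤ R) :
    ∃ S : List InputWord,
      (∀ s ∈ S, wordValue x g s ∈ Subgroup.closure (Set.range x) ∧
        displacement v₀ (wordValue x g s) ≤ R) ∧
      (∀ h ∈ Subgroup.closure (Set.range x), displacement v₀ h ≤ R →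
        ∃ s ∈ S, wordValue x g s = h) ∧
      [] ∈ S ∧ ∀ i < n, [(some i, true)] ∈ S ∧ [(some i, false)] ∈ S := by
  classical
  have hfin := hG.finite_displacement_le hT (Set.finite_range x) v₀ R
  have hword : ∀ h : T ≃g T, ∃ s : InputWord, h ∈ Subgroup.closure (Set.range x) →
      wordValue x g s = h := by
    intro h
    by_cases hh : h ∈ Subgroup.closure (Set.range x)
    · obtain ⟨w, hw⟩ := exists_word_of_mem_closure x hh
      exact ⟨_, fun _ => (wordValue_toInput x g w).trans hw⟩
    · exact ⟨[], fun h' => absurd h' hh⟩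
  choose word hword using hword
  -- `ContainsGenerators` compares words, not their values, so these literal words are added to the
  -- words chosen for the ball.
  refine ⟨[] :: ((List.range n).map (fun i => [(some i, true)]) ++
    ((List.range n).map (fun i => [(some i, false)]) ++ hfin.toFinset.toList.map word)),
    ?_, ?_, ?_, ?_⟩
  · intro s hs
    simp only [List.mem_cons, List.mem_append, List.mem_map, List.mem_range, Finset.mem_toList,
      Set.Finite.mem_toFinset] at hs
    obtain rfl | ⟨i, hi, rfl⟩ | ⟨i, hi, rfl⟩ | ⟨h, hh, rfl⟩ := hs
    · simp [one_mem]
    · have := wordValue_generator x g ⟨i, hi⟩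
      simp only at this
      rw [this]
      exact ⟨Subgroup.subset_closure ⟨_, rfl⟩, hR _⟩
    · have := wordValue_generator_inv x g ⟨i, hi⟩
      simp only at this
      rw [this, displacement_inv]
      exact ⟨inv_mem (Subgroup.subset_closure ⟨_, rfl⟩), hR _⟩
    · rw [hword h hh.1]
      exact hh
  · intro h hh hle
    refine ⟨word h, ?_, hword h hh⟩
    simp only [List.mem_cons, List.mem_append, List.mem_map, Finset.mem_toList,
      Set.Finite.mem_toFinset]
    exact .inr (.inr (.inr ⟨h, ⟨hh, hle⟩, rfl⟩))
  · simp
  · intro i hi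
    simp [hi]

theorem exists_refutes (hT : T.IsTree) (hG : IsPurelyHyperbolic (Subgroup.closure (Set.range x)))
    (hg : g ∉ Subgroup.closure (Set.range x)) :
    ∃ k, Refutes ((n, history (answer v₀ x g) k), certificate k) := by
  -- The ball has to contain the generators, and `g` has to lie within its bound.
  let R : ℕ := (Finset.univ.sup fun i => displacement v₀ (x i)) + displacement v₀ g
  have hR : ∀ i, displacement v₀ (x i) ≤ R := fun i =>
    (Finset.le_sup (f := fun i => displacement v₀ (x i)) (Finset.mem_univ i)).trans
      (Nat.le_add_right _ _)
  obtain ⟨S, hS, hS', hnil, hgen⟩ := exists_words hT hG g hR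
  -- The sum dominates the code of every word that `Refutes` looks up, so after `m` queries all are
  -- answered.
  obtain ⟨m, hm⟩ := exists_forall_mem_lt (S ×ˢ S ×ˢ S) fun p =>
    encode p.1 + encode (leftDiv p.1 [(none, true)]) + encode (p.1 ++ p.2.1) +
      encode (leftDiv p.2.2 (p.1 ++ p.2.1)) + encode ([(none, true)] : InputWord)
  have hm' : ∀ s ∈ S, ∀ t ∈ S, ∀ u ∈ S, _ := fun s hs t ht u hu =>
    hm (s, t, u) (List.mem_product.2 ⟨hs, List.mem_product.2 ⟨ht, hu⟩⟩)
  obtain ⟨k, hk, hc⟩ := exists_certificate_eq (S, R, []) m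
  have hle : ∀ w : InputWord, encode w < k → displacement v₀ (wordValue x g w) ≤ R →
      ShowsLe w ((n, history (answer v₀ x g) k), (S, R, [])) := by
    intro w hw hd
    refine ⟨by simpa [IsKnown] using hw, ?_⟩
    simpa only [lookup_history hw, answer_snd] using hd
  refine ⟨k, ?_⟩
  rw [hc]
  refine ⟨⟨hnil, hgen⟩, fun s hs => hle s ?_ (hS s hs).2, fun s hs t ht => ?_, hle _ ?_ ?_,
    fun u hu => ?_⟩
  · have := hm' s hs s hs s hs
    simp only at this
    omega
  · by_cases hd : displacement v₀ (wordValue x g (s ++ t)) ≤ R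
    · have hst : wordValue x g (s ++ t) ∈ Subgroup.closure (Set.range x) := by
        rw [wordValue_append]
        exact mul_mem (hS s hs).1 (hS t ht).1
      obtain ⟨u, hu, hus⟩ := hS' _ hst hd
      have := hm' s hs t ht u hu
      simp only at this
      refine .inr ⟨u, hu, ?_⟩
      simp only
      rw [lookup_history (by omega), answer_fst, wordValue_leftDiv_eq_one, hus]
    · have := hm' s hs t ht s hs
      simp only at this
      refine .inl ?_
      simp only
      rw [lookup_history (by omega), answer_snd]
      exact not_le.1 hd
  -- The bound on the code of the word for `g` needs some triple from `S`; the empty word provides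
  -- one.
  · have := hm' _ hnil _ hnil _ hnil
    simp only at this
    omega
  · rw [wordValue_last]
    exact Nat.le_add_left _ _
  · have := hm' u hu u hu u hu
    simp only at this
    have hlt : encode (leftDiv u [(none, true)]) < k := by omega
    refine ⟨by simpa [IsKnown] using hlt, ?_⟩
    simp only
    rw [lookup_history hlt, ← Bool.not_eq_true, answer_fst, wordValue_leftDiv_eq_one,
      wordValue_last]
    intro h
    exact hg (h ▸ (hS u hu).1)

theorem move_sound (hT : T.IsTree) {k : ℕ} {out : Option GenWord}
    (h : move (n, history (answer v₀ x g) k) = .inr out) :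
    (∃ w : List (Fin n × Bool), FreeGroup.lift x (FreeGroup.mk w) = g ∧
        out = some (w.map fun a => (a.1.val, a.2))) ∨
      g ∉ Subgroup.closure (Set.range x) ∧ out = none := by
  rw [move] at h
  split_ifs at h with h1 h2
  · obtain ⟨w, hw, hw'⟩ := h1.exists_word
    exact .inl ⟨w, hw, by rw [← hw']; exact (Sum.inr_injective h).symm⟩
  · exact .inr ⟨h2.notMem hT, (Sum.inr_injective h).symm⟩

theorem exists_isRight_move (hT : T.IsTree)
    (hG : IsPurelyHyperbolic (Subgroup.closure (Set.range x))) :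
    ∃ k, (move (n, history (answer v₀ x g) k)).isRight := by
  by_cases hg : g ∈ Subgroup.closure (Set.range x)
  · obtain ⟨k, hk⟩ := exists_confirms (v₀ := v₀) hg
    exact ⟨k, by simp [move, hk]⟩
  · obtain ⟨k, hk⟩ := exists_refutes (v₀ := v₀) hT hG hg
    refine ⟨k, ?_⟩
    rw [move]
    split_ifs <;> simp_all

end Correctness

end TreeMembership

theorem theoremC :
    ∃ A : TreeMembership.Algorithm,
      ∀ (V : Type u) (T : SimpleGraph V), T.IsTree →
        ∀ (v₀ : V) (G : Subgroup (T ≃g T)), TreeMembership.IsPurelyHyperbolic G →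
          ∀ (n : ℕ) (x : Fin n → (T ≃g T)), Subgroup.closure (Set.range x) = G →
            A.SolvesConstructiveMembership v₀ G x := by
  refine ⟨TreeMembership.certificateSearch, ?_⟩
  rintro V T hT v₀ _ hG n x rfl g
  obtain ⟨j, hj⟩ := TreeMembership.exists_isRight_move (v₀ := v₀) (g := g) hT hG
  obtain ⟨out, hout, k, hk⟩ := TreeMembership.exists_outputs hj
  obtain ⟨w, hw, rfl⟩ | ⟨hg, rfl⟩ := TreeMembership.move_sound hT hk
  · refine ⟨fun _ => ⟨w, hw, hout⟩, fun hg => absurd ?_ hg⟩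
    rw [← FreeGroup.range_lift_eq_closure, ← hw]
    exact ⟨_, rfl⟩
  · exact ⟨fun h => absurd h hg, fun _ => hout⟩
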